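/- Let $\mathbb{H}=\{-1,0,1\}$, let $\mathbb{Z}_+$ be the set of nonnegative integers, and let $S_0$ be a finite nonempty set. Let $P$ be the transition matrix of a Markov chain on $\mathbb{Z}^3\times S_0$ that is skip-free ($p_{(\mathbf{x},j),(\mathbf{x}',j')}\neq 0$ only if $\mathbf{x}'-\mathbf{x}\in\mathbb{H}^3$) and space-homogeneous ($p_{(\mathbf{x}+\mathbf{k},j),(\mathbf{x}'+\mathbf{k},j')}=p_{(\mathbf{x},j),(\mathbf{x}',j')}$ for all $\mathbf{k}\in\mathbb{Z}^3$). For $\mathbf{k}\in\mathbb{H}^3$ put $A_{\mathbf{k}}=(p_{(\mathbf{0},j),(\mathbf{k},j')})_{j,j'\in S_0}$, and for $z_1,z_2,z_3>0$ $$A_{***}(z_1,z_2,z_3)=\sum_{\mathbf{k}\in\mathbb{H}^3} z_1^{k_1}z_2^{k_2}z_3^{k_3}A_{\mathbf{k}} .$$ Let $\pi$ be a stationary probability distribution of $A_{***}(1,1,1)$, and let $\mathbf{a}=(a_1,a_2,a_3)$ be the mean drift vector, $$a_i=\pi\Bigl(\sum_{\mathbf{k}\in\mathbb{H}^3:\,k_i=1}A_{\mathbf{k}}-\sum_{\mathbf{k}\in\mathbb{H}^3:\,k_i=-1}A_{\mathbf{k}}\Bigr)\mathbf{e},$$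 where $\mathbf{e}$ is the column vector of ones. Let $Q$ be the restriction of $P$ to $\mathbb{Z}_+^3\times S_0$. For $i\in\{1,2,3\}$, take the $i$-th coordinate as level and the two other coordinates together with the background state as phase, so that the phase space is a copy of the countably infinite set $\mathbb{Z}_+^2\times S_0$. Then $Q$ is the block tri-diagonal matrix with blocks $A^{(i)}_{-1},A^{(i)}_0,A^{(i)}_1$, indexed by pairs of phases, where $A^{(i)}_k$ contains the transition probabilities from a phase to a phase when the level changes by $k$. The rate matrix of this representation is the matrix, with entries in $[0,\infty]$, $$R^{(i)}=\sum_{n=1}^{\infty}\ \sum_{(i_1,\dots,i_n)\in\mathscr{I}_n}A^{(i)}_{i_1}A^{(i)}_{i_2}\cdots A^{(i)}_{i_n},$$ $$\mathscr{I}_n=\Bigl\{(i_1,\dots,i_n)\in\mathbb{H}^n:\ \sum_{l=1}^k i_l\ge 1\ (1\le k\le n-1),\ \sum_{l=1}^n i_l=1\Bigr\}.$$ For a nonnegative matrix $A$ with a finite or countable index set, let $\mathrm{cp}(A)=\sup\{z\in[0,\infty):\ \sum_{n\ge 0}z^nA^n<\infty \text{ entrywise}\}\in[0,\infty]$ be its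 convergence parameter. Let $\chi(z_1,z_2,z_3)=\mathrm{cp}(A_{***}(z_1,z_2,z_3))^{-1}$ and $$z_i^{\max}=\exp\Bigl(\sup\bigl\{s_i:\ (s_1,s_2,s_3)\in\mathbb{R}^3,\ \chi(e^{s_1},e^{s_2},e^{s_3})\le 1\bigr\}\Bigr).$$ Assume that 1. $a_1,a_2,a_3$ are all nonzero and at least one of them is negative; 2. $Q$ is irreducible and aperiodic; 3. for every $i\in\{1,2,3\}$, every row of $A^{(i)}_1$ has at least one positive element. Then, for $i=1,2,3$, every entry of the rate matrix $R^{(i)}$ is finite and $$\mathrm{cp}(R^{(i)})\ \ge\ z_i^{\max}.$$ -/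

import Mathlib

open scoped ENNReal

noncomputable section

/-! ### Nonnegative matrices with countably many rows and columns -/

namespace CMatrix

variable {ι : Type*}

/-- Product of two nonnegative matrices with a countable index set; an entry may be infinite. -/
def mul (A B : Matrix ι ι ℝ≥0∞) : Matrix ι ι ℝ≥0∞ :=
  fun i j => ∑' k, A i k * B k j

open Classical in
/-- The identity matrix. -/
def id : Matrix ι ι ℝ≥0∞ := fun i j => if i = j then 1 else 0

/-- The iterates of a nonnegative matrix: `A ^ 0 = I` and `A ^ (n + 1) = A ^ n * A`. -/
def pow (A : Matrix ι ι ℝ≥0∞) : ℕ → Matrix ι ι ℝ≥0∞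
  | 0 => id
  | n + 1 => mul (pow A n) A

/-- The product of a list of matrices, from left to right. -/
def listProd (l : List (Matrix ι ι ℝ≥0∞)) : Matrix ι ι ℝ≥0∞ :=
  l.foldr mul id

/-- The convergence parameter: the supremum of all `z ≥ 0` for which every entry of
`∑ n, z ^ n A ^ n` is finite. The value `∞` is allowed. -/
def cp (A : Matrix ι ι ℝ≥0∞) : ℝ≥0∞ :=
  sSup {z : ℝ≥0∞ | z ≠ ∞ ∧ ∀ i j, ∑' n : ℕ, z ^ n * pow A n i j < ∞}

/-- A real nonnegative matrix seen as a matrix with entries in `[0, ∞]`. -/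
def ofReal (A : Matrix ι ι ℝ) : Matrix ι ι ℝ≥0∞ := A.map ENNReal.ofReal

/-- Aperiodicity of a nonnegative matrix: for every state, the greatest common divisor of the
`n ≥ 1` for which the `n`-step diagonal entry is positive equals `1`. -/
def IsAperiodic (A : Matrix ι ι ℝ) : Prop :=
  ∀ i, ∀ d : ℕ, (∀ n, 1 ≤ n → 0 < pow (ofReal A) n i i → d ∣ n) → d = 1

/-- Index sequences `(i₁, …, iₙ)` in `{-1, 0, 1}` whose partial sums of length `1, …, n - 1` are
at least `1` and whose total sum is `1`. -/
def upSeq (n : ℕ) : Finset (Fin n → ℤ) :=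
  open Classical in
  (Fintype.piFinset fun _ : Fin n => Finset.Icc (-1 : ℤ) 1).filter fun s =>
    (∀ k : ℕ, 1 ≤ k → k < n → 1 ≤ ∑ l : Fin n with l.val < k, s l) ∧ ∑ l, s l = 1

/-- The rate matrix `R = ∑_{n ≥ 1} ∑_{(i₁, …, iₙ)} A_{i₁} ⋯ A_{iₙ}` of the triplet
`(A (-1), A 0, A 1)`, the inner sum being over `upSeq n`. -/
def rateMatrix (A : ℤ → Matrix ι ι ℝ≥0∞) : Matrix ι ι ℝ≥0∞ :=
  fun u v => ∑' n : ℕ, ∑ s ∈ upSeq (n + 1), listProd (List.ofFn fun l => A (s l)) u v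

end CMatrix

/-! ### Three-dimensional skip-free Markov modulated random walks -/

namespace MMRW

/-- The state space `ℤ³ × S`. -/
abbrev State (S : Type*) := (Fin 3 → ℤ) × S

/-- The nonnegative part `ℤ₊³ × S` of the state space. -/
abbrev StatePos (S : Type*) := (Fin 3 → ℕ) × S

/-- The primary phase space when coordinate `i` is the level: the two other coordinates, in `ℤ₊`,
and the background state. -/
abbrev Phase (S : Type*) (i : Fin 3) := ({l : Fin 3 // l ≠ i} → ℕ) × S

variable {S : Type*}

/-- `P` is the transition matrix of a skip-free, space-homogeneous Markov modulated random walk on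
`ℤ³` with background states in `S`. -/
structure IsTransition (P : Matrix (State S) (State S) ℝ) : Prop where
  nonneg : ∀ y y', 0 ≤ P y y'
  stochastic : ∀ y, HasSum (fun y' => P y y') 1
  skipFree : ∀ x j x' j', P (x, j) (x', j') ≠ 0 → ∀ i, x' i - x i ∈ Finset.Icc (-1 : ℤ) 1
  homogeneous : ∀ k x j x' j', P (x + k, j) (x' + k, j') = P (x, j) (x', j')

/-- The increments `{-1, 0, 1}³`. -/
def increments : Finset (Fin 3 → ℤ) := Fintype.piFinset fun _ => Finset.Icc (-1) 1

/-- The block `A_k`, `k ∈ ℤ³`, of transition probabilities with increment `k`. -/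
def incrBlock (P : Matrix (State S) (State S) ℝ) (k : Fin 3 → ℤ) : Matrix S S ℝ :=
  fun j j' => P (0, j) (k, j')

/-- `A_{***}(z₁, z₂, z₃) = ∑_k z₁^{k₁} z₂^{k₂} z₃^{k₃} A_k`. -/
def genMatrix (P : Matrix (State S) (State S) ℝ) (z : Fin 3 → ℝ) : Matrix S S ℝ :=
  ∑ k ∈ increments, (∏ i, z i ^ k i) • incrBlock P k

/-- `π` is a stationary probability distribution of `A_{***} = A_{***}(1, 1, 1)`. -/
def IsStationary [Fintype S] (P : Matrix (State S) (State S) ℝ) (π : S → ℝ) : Prop :=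
  π ∈ stdSimplex ℝ S ∧ Matrix.vecMul π (genMatrix P 1) = π

/-- The `i`-th coordinate of the mean drift vector: `π (∑_{k : k_i = 1} A_k - ∑_{k : k_i = -1} A_k) e`. -/
def meanDrift [Fintype S] (P : Matrix (State S) (State S) ℝ) (π : S → ℝ) (i : Fin 3) : ℝ :=
  dotProduct π (Matrix.mulVec
    (∑ k ∈ increments with k i = 1, incrBlock P k - ∑ k ∈ increments with k i = -1, incrBlock P k)
    1)

/-- The truncation `Q` of `P` to `ℤ₊³ × S`. -/
def trunc (P : Matrix (State S) (State S) ℝ) : Matrix (StatePos S) (StatePos S) ℝ :=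
  fun y y' => P (fun l => (y.1 l : ℤ), y.2) (fun l => (y'.1 l : ℤ), y'.2)

/-- The point of `ℤ³` whose `i`-th coordinate is `a` and whose other coordinates are given by `u`. -/
def withLevel (i : Fin 3) (a : ℤ) (u : {l : Fin 3 // l ≠ i} → ℕ) : Fin 3 → ℤ :=
  fun l => if h : l = i then a else (u ⟨l, h⟩ : ℤ)

/-- The block `A_k^{(i)}` of the block tri-diagonal representation `Q^{(i)}` of `Q` whose level is
coordinate `i`: the transition probabilities between phases when the level moves by `k`. -/
def levelBlock (P : Matrix (State S) (State S) ℝ) (i : Fin 3) (k : ℤ) :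
    Matrix (Phase S i) (Phase S i) ℝ :=
  fun u v => P (withLevel i 0 u.1, u.2) (withLevel i k v.1, v.2)

/-- The representation of `Q` in blocks: the transition from level `y.1 i` to level `y'.1 i` is
given by the block indexed by the difference of the levels, and vanishes if that difference is
not in `{-1, 0, 1}`. -/
theorem trunc_eq_levelBlock {P : Matrix (State S) (State S) ℝ} (hP : IsTransition P) (i : Fin 3)
    (y y' : StatePos S) :
    trunc P y y' =
      if (y'.1 i : ℤ) - y.1 i ∈ Finset.Icc (-1 : ℤ) 1 then
        levelBlock P i ((y'.1 i : ℤ) - y.1 i) (fun l => y.1 l, y.2) (fun l => y'.1 l, y'.2)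
      else 0 := by
  split_ifs with h
  · have key := hP.homogeneous (fun l => if l = i then (y.1 i : ℤ) else 0)
      (withLevel i 0 fun l => y.1 l) y.2
      (withLevel i ((y'.1 i : ℤ) - y.1 i) fun l => y'.1 l) y'.2
    rw [levelBlock, ← key, trunc]
    congr 2
    · funext l
      by_cases hl : l = i
      · subst hl; simp [withLevel]
      · simp [withLevel, hl]
    · funext l
      by_cases hl : l = i
      · subst hl; simp [withLevel]
      · simp [withLevel, hl]
  · by_contra h0
    exact h (hP.skipFree _ _ _ _ h0 i)

/-- The rate matrix `R^{(i)}` of `Q^{(i)}`. -/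
def rate (P : Matrix (State S) (State S) ℝ) (i : Fin 3) :
    Matrix (Phase S i) (Phase S i) ℝ≥0∞ :=
  CMatrix.rateMatrix fun k => CMatrix.ofReal (levelBlock P i k)

/-- `χ(z₁, z₂, z₃)`: the reciprocal of the convergence parameter of `A_{***}(z₁, z₂, z₃)`. -/
def chi (P : Matrix (State S) (State S) ℝ) (z : Fin 3 → ℝ) : ℝ≥0∞ :=
  (CMatrix.cp (CMatrix.ofReal (genMatrix P z)))⁻¹

/-- The set of `s ∈ ℝ³` with `χ(e^{s₁}, e^{s₂}, e^{s₃}) ≤ 1`. -/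
def gammaBar (P : Matrix (State S) (State S) ℝ) : Set (Fin 3 → ℝ) :=
  {s | chi P (fun l => Real.exp (s l)) ≤ 1}

/-- `s_i^max`, the supremum of `s_i` over `gammaBar P`, taken in the extended reals. -/
def sMax (P : Matrix (State S) (State S) ℝ) (i : Fin 3) : EReal :=
  ⨆ s ∈ gammaBar P, ((s i : ℝ) : EReal)

/-- `z_i^max = exp (s_i^max)`. -/
def zMax (P : Matrix (State S) (State S) ℝ) (i : Fin 3) : ℝ≥0∞ := EReal.exp (sMax P i)

end MMRW

end

/-! A product of n rate matrices expands into products of blocks along level paths that climb n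
levels. A path splits into its n ascending segments in at most one way, so `R ^ n` is at most the
sum over all words with sum n (`pow_rateMatrix_le`). After weighting each block by `z ^ k`, the
series `∑ z ^ n R ^ n` is therefore bounded by the Green matrix of `∑ k, z ^ k A_k`. This is finite
once some positive finite `f` is contracted by a factor `θ < 1` (`tsum_pow_rateMatrix_lt_top`).

For the random walk take `f (x, j) = exp (⟨s, x⟩ + φ j)` with level coordinate 0, and `z = exp (s
i)`. By homogeneity the contraction reduces to `A_{***}(exp ∘ s) (exp ∘ φ) ≤ exp c • (exp ∘ φ)` with
`c < 0`; truncation to the orthant only discards mass.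

A point of `gammaBar` supplies such vectors only for every `c > 0`. A nonzero drift supplies one
point with `c < 0`, by perturbing around the origin with a corrector that solves Poisson's equation.
Triples `(s, φ, c)` form a convex set, so moving slightly from a point of `gammaBar` towards that
strict point makes `c` negative, and a limit gives the bound. -/

namespace CMatrix

variable {ι : Type*}

/-! ### Algebra of nonnegative matrices. -/

lemma id_mul (A : Matrix ι ι ℝ≥0∞) : mul id A = A := by
  classical
  ext i j
  rw [mul, tsum_eq_single i fun k hk => by simp [id, hk.symm]]
  simp [id]

lemma mul_id (A : Matrix ι ι ℝ≥0∞) : mul A id = A := by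
  classical
  ext i j
  rw [mul, tsum_eq_single j fun k hk => by simp [id, hk]]
  simp [id]

lemma mul_assoc (A B C : Matrix ι ι ℝ≥0∞) : mul (mul A B) C = mul A (mul B C) := by
  ext i j
  simp only [mul, ← ENNReal.tsum_mul_left, ← ENNReal.tsum_mul_right]
  rw [ENNReal.tsum_comm]
  simp only [_root_.mul_assoc]

lemma pow_one (A : Matrix ι ι ℝ≥0∞) : pow A 1 = A := id_mul A

lemma pow_succ' (A : Matrix ι ι ℝ≥0∞) (n : ℕ) : pow A (n + 1) = mul A (pow A n) := by
  induction n with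
  | zero => exact (id_mul A).trans (mul_id A).symm
  | succ n ih =>
    calc pow A (n + 2) = mul (mul A (pow A n)) A := by rw [← ih]; rfl
      _ = mul A (pow A (n + 1)) := mul_assoc _ _ _

lemma listProd_cons (A : Matrix ι ι ℝ≥0∞) (l : List (Matrix ι ι ℝ≥0∞)) :
    listProd (A :: l) = mul A (listProd l) := rfl

lemma listProd_append (l l' : List (Matrix ι ι ℝ≥0∞)) :
    listProd (l ++ l') = mul (listProd l) (listProd l') := by
  induction l with
  | nil => exact (id_mul _).symm
  | cons A l ih => rw [List.cons_append, listProd_cons, ih, listProd_cons, mul_assoc]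

/-! ### Path decomposition of the iterates of the rate matrix. -/

/-- Lists of integers whose proper nonempty prefixes have sum at least `1` and whose total sum
is `1`. -/
def IsUp (l : List ℤ) : Prop :=
  (∀ k, 1 ≤ k → k < l.length → 1 ≤ (l.take k).sum) ∧ l.sum = 1

lemma IsUp.eq_nil_of_append {q s : List ℤ} (h : IsUp (q ++ s)) (hq : q.sum = 0) : q = [] := by
  by_contra hne
  have hpos : 1 ≤ q.length := List.length_pos_iff.2 hne
  rcases eq_or_ne s [] with rfl | hs
  · have := h.2
    simp [hq] at this
  · have hlen : q.length < (q ++ s).length := by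
      simpa using List.length_pos_iff.2 hs
    have := h.1 q.length hpos hlen
    simp [hq] at this

/-- Two cuts at the same height differ by a piece of sum 0 that starts an ascending segment, and
such a piece must be empty. This makes splitting off the last segment unambiguous, hence
concatenation injective in `pow_rateMatrix_le`. -/
lemma IsUp.append_inj {p p' s s' : List ℤ} (hs : IsUp s) (hs' : IsUp s') (hp : p.sum = p'.sum)
    (h : p ++ s = p' ++ s') : p = p' ∧ s = s' := by
  rcases List.append_eq_append_iff.1 h with ⟨q, rfl, rfl⟩ | ⟨q, rfl, rfl⟩
  · have := hs.eq_nil_of_append (by simpa using hp)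
    simp [this]
  · have := hs'.eq_nil_of_append (by simpa using hp)
    simp [this]

lemma isUp_ofFn {n : ℕ} {s : Fin n → ℤ} (hs : s ∈ upSeq n) : IsUp (List.ofFn s) := by
  classical
  simp only [upSeq, Finset.mem_filter] at hs
  refine ⟨fun k h1 hk => ?_, by rw [List.sum_ofFn]; exact hs.2.2⟩
  rw [List.sum_take_ofFn]
  exact hs.2.1 k h1 (by simpa using hk)

lemma rateMatrix_le (A : ℤ → Matrix ι ι ℝ≥0∞) (u v : ι) :
    rateMatrix A u v ≤ ∑' l : {l : List ℤ // IsUp l}, listProd (l.1.map A) u v := by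
  have h1 : rateMatrix A u v = ∑' x : Σ n : ℕ, {s // s ∈ upSeq (n + 1)},
      listProd ((List.ofFn x.2.1).map A) u v := by
    rw [ENNReal.tsum_sigma', rateMatrix]
    refine tsum_congr fun n => ?_
    rw [Finset.tsum_subtype (upSeq (n + 1)) fun s => listProd ((List.ofFn s).map A) u v]
    exact Finset.sum_congr rfl fun s _ => by rw [List.map_ofFn]; rfl
  rw [h1]
  let g : (Σ n : ℕ, {s // s ∈ upSeq (n + 1)}) → {l : List ℤ // IsUp l} :=
    fun x => ⟨List.ofFn x.2.1, isUp_ofFn x.2.2⟩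
  refine ENNReal.tsum_comp_le_tsum_of_injective (f := g) ?_ fun l => listProd (l.1.map A) u v
  rintro ⟨n, s, hs⟩ ⟨m, t, ht⟩ h
  have h := Subtype.ext_iff.1 h
  have hnm : n = m := by simpa [g] using congrArg List.length h
  subst hnm
  have := List.ofFn_injective h
  simp only at this
  subst this
  rfl

/-- The `n`-th iterate of the rate matrix is dominated by the sum over all level paths that lead
`n` levels up. -/
lemma pow_rateMatrix_le (A : ℤ → Matrix ι ι ℝ≥0∞) (n : ℕ) (u v : ι) :
    pow (rateMatrix A) n u v ≤
      ∑' l : {l : List ℤ // l.sum = n}, listProd (l.1.map A) u v := by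
  induction n generalizing v with
  | zero => exact ENNReal.le_tsum (⟨[], rfl⟩ : {l : List ℤ // l.sum = ((0 : ℕ) : ℤ)})
  | succ n ih =>
    calc pow (rateMatrix A) (n + 1) u v
        = ∑' w, pow (rateMatrix A) n u w * rateMatrix A w v := rfl
      _ ≤ ∑' w, (∑' l : {l : List ℤ // l.sum = n}, listProd (l.1.map A) u w) *
            ∑' l : {l : List ℤ // IsUp l}, listProd (l.1.map A) w v :=
          ENNReal.tsum_le_tsum fun w => mul_le_mul' (ih w) (rateMatrix_le A w v)
      _ = ∑' x : {l : List ℤ // l.sum = n} × {l : List ℤ // IsUp l},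
            listProd ((x.1.1 ++ x.2.1).map A) u v := by
          simp only [List.map_append, listProd_append, mul, ← ENNReal.tsum_mul_left,
            ← ENNReal.tsum_mul_right]
          rw [ENNReal.tsum_prod', ENNReal.tsum_comm]
          conv_lhs =>
            enter [1, l]
            rw [ENNReal.tsum_comm]
          rw [ENNReal.tsum_comm]
      _ ≤ _ := by
          let g : {l : List ℤ // l.sum = n} × {l : List ℤ // IsUp l} →
              {l : List ℤ // l.sum = (n + 1 : ℕ)} :=
            fun x => ⟨x.1.1 ++ x.2.1, by simp [x.1.2, x.2.2.2]⟩
          refine ENNReal.tsum_comp_le_tsum_of_injective (f := g) ?_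
            fun l => listProd (l.1.map A) u v
          rintro ⟨⟨p, hp⟩, s, hs⟩ ⟨⟨p', hp'⟩, s', hs'⟩ h
          obtain ⟨rfl, rfl⟩ := hs.append_inj hs' (hp.trans hp'.symm) (Subtype.ext_iff.1 h)
          rfl

lemma listProd_map_zpow (A : ℤ → Matrix ι ι ℝ≥0∞) {z : ℝ≥0∞} (h0 : z ≠ 0) (hz : z ≠ ∞)
    (l : List ℤ) (u v : ι) :
    listProd (l.map fun k => z ^ k • A k) u v = z ^ l.sum * listProd (l.map A) u v := by
  induction l generalizing u with
  | nil => simp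
  | cons k l ih =>
    simp only [List.map_cons, listProd_cons, mul, List.sum_cons, ih, ← ENNReal.tsum_mul_left,
      ENNReal.zpow_add h0 hz, Matrix.smul_apply, smul_eq_mul]
    exact tsum_congr fun w => by ring

/-- The factor `z ^ n` is absorbed into the blocks because the increments of a contributing word sum
to n. Words of different sums are different, so summing over n counts each word at most once. -/
lemma tsum_pow_rateMatrix_le (A : ℤ → Matrix ι ι ℝ≥0∞) {z : ℝ≥0∞} (h0 : z ≠ 0) (hz : z ≠ ∞)
    (u v : ι) :
    ∑' n : ℕ, z ^ n * pow (rateMatrix A) n u v ≤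
      ∑' l : List ℤ, listProd (l.map fun k => z ^ k • A k) u v := by
  calc ∑' n : ℕ, z ^ n * pow (rateMatrix A) n u v
      ≤ ∑' n : ℕ, ∑' l : {l : List ℤ // l.sum = n},
          listProd (l.1.map fun k => z ^ k • A k) u v := by
        refine ENNReal.tsum_le_tsum fun n => ?_
        refine (mul_le_mul_right (pow_rateMatrix_le A n u v) _).trans_eq ?_
        rw [← ENNReal.tsum_mul_left]
        refine tsum_congr fun l => ?_
        rw [listProd_map_zpow A h0 hz, l.2, zpow_natCast]
    _ = ∑' x : Σ n : ℕ, {l : List ℤ // l.sum = n},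
          listProd (x.2.1.map fun k => z ^ k • A k) u v := by rw [ENNReal.tsum_sigma']
    _ ≤ _ := by
        refine ENNReal.tsum_comp_le_tsum_of_injective
          (f := fun x : Σ n : ℕ, {l : List ℤ // l.sum = n} => x.2.1) ?_
          fun l => listProd (l.map fun k => z ^ k • A k) u v
        rintro ⟨n, l, hl⟩ ⟨m, l', hl'⟩ h
        obtain rfl : l = l' := h
        obtain rfl : n = m := by exact_mod_cast hl.symm.trans hl'
        rfl

/-! ### Superharmonic functions and finiteness of the Green matrix. -/

lemma tsum_listProd_ofFn_le {B : ℤ → Matrix ι ι ℝ≥0∞} {f : ι → ℝ≥0∞} {θ : ℝ≥0∞}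
    (h : ∀ u, ∑' k, ∑' v, B k u v * f v ≤ θ * f u) (m : ℕ) (u : ι) :
    ∑' s : Fin m → ℤ, ∑' v, listProd ((List.ofFn s).map B) u v * f v ≤ θ ^ m * f u := by
  induction m generalizing u with
  | zero =>
    classical
    rw [tsum_eq_single default fun s hs => (hs (Subsingleton.elim _ _)).elim,
      tsum_eq_single u fun v hv => by simp [listProd, id, hv.symm]]
    simp [listProd, id]
  | succ m ih =>
    rw [← (Fin.consEquiv fun _ : Fin (m + 1) => ℤ).tsum_eq, ENNReal.tsum_prod']
    calc _ = ∑' k, ∑' w, B k u w *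
          ∑' s : Fin m → ℤ, ∑' v, listProd ((List.ofFn s).map B) w v * f v := by
          refine tsum_congr fun k => ?_
          simp only [Fin.consEquiv, Equiv.coe_fn_mk, List.ofFn_succ, Fin.cons_zero, Fin.cons_succ,
            List.map_cons, listProd_cons, mul, ← ENNReal.tsum_mul_left, ← ENNReal.tsum_mul_right]
          rw [ENNReal.tsum_comm (α := ι)]
          refine tsum_congr fun s => ?_
          rw [ENNReal.tsum_comm]
          simp only [_root_.mul_assoc]
      _ ≤ ∑' k, ∑' w, B k u w * (θ ^ m * f w) := by
          gcongr
          exact ih _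
      _ = θ ^ m * ∑' k, ∑' w, B k u w * f w := by
          simp only [← ENNReal.tsum_mul_left]
          exact tsum_congr fun k => tsum_congr fun w => by ring
      _ ≤ θ ^ m * (θ * f u) := by gcongr; exact h u
      _ = _ := by ring

/-- A strictly superharmonic function of the twisted blocks bounds the generating function of the
iterates of the rate matrix. -/
lemma tsum_pow_rateMatrix_lt_top {A : ℤ → Matrix ι ι ℝ≥0∞} {z : ℝ≥0∞} (h0 : z ≠ 0) (hz : z ≠ ∞)
    {f : ι → ℝ≥0∞} (hf0 : ∀ v, f v ≠ 0) (hf : ∀ v, f v ≠ ∞) {θ : ℝ≥0∞} (hθ : θ < 1)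
    (h : ∀ u, ∑' k : ℤ, ∑' v, z ^ k * A k u v * f v ≤ θ * f u) (u v : ι) :
    ∑' n : ℕ, z ^ n * pow (rateMatrix A) n u v < ∞ := by
  refine (tsum_pow_rateMatrix_le A h0 hz u v).trans_lt ?_
  set B : ℤ → Matrix ι ι ℝ≥0∞ := fun k => z ^ k • A k
  have key : ∑' l : List ℤ, ∑' v, listProd (l.map B) u v * f v < ∞ := by
    rw [← List.equivSigmaTuple.symm.tsum_eq, ENNReal.tsum_sigma']
    refine (ENNReal.tsum_le_tsum fun m => tsum_listProd_ofFn_le (B := B) h m u).trans_lt ?_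
    rw [ENNReal.tsum_mul_right, ENNReal.tsum_geometric]
    exact ENNReal.mul_lt_top (ENNReal.inv_lt_top.2 (tsub_pos_of_lt hθ)) (hf u).lt_top
  have h1 : (∑' l : List ℤ, listProd (l.map B) u v) * f v < ∞ := by
    rw [← ENNReal.tsum_mul_right]
    exact (ENNReal.tsum_le_tsum fun l => ENNReal.le_tsum (f := fun v => _ * f v) v).trans_lt key
  exact ENNReal.lt_top_of_mul_ne_top_left h1.ne (hf0 v)

end CMatrix

namespace MMRW

open Filter Topology

/-! ### Subinvariant vectors of the generating matrix. -/

lemma ofReal_exp_zpow (x : ℝ) (k : ℤ) :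
    ENNReal.ofReal (Real.exp x) ^ k = ENNReal.ofReal (Real.exp (x * k)) := by
  rw [← ENNReal.rpow_intCast, ENNReal.ofReal_rpow_of_pos (Real.exp_pos _), ← Real.exp_mul]

variable {S : Type*}

variable {P : Matrix (State S) (State S) ℝ}

lemma mem_increments_of_ne_zero (hP : IsTransition P) {k : Fin 3 → ℤ} {j j' : S}
    (h : P (0, j) (k, j') ≠ 0) : k ∈ increments :=
  Fintype.mem_piFinset.2 fun i => by simpa using hP.skipFree _ _ _ _ h i

lemma genMatrix_apply (z : Fin 3 → ℝ) (j j' : S) :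
    genMatrix P z j j' = ∑ k ∈ increments, (∏ i, z i ^ k i) * P (0, j) (k, j') := by
  simp [genMatrix, Matrix.sum_apply, incrBlock]

lemma genMatrix_exp_apply (s : Fin 3 → ℝ) (j j' : S) :
    genMatrix P (fun l => Real.exp (s l)) j j' =
      ∑ k ∈ increments, P (0, j) (k, j') * Real.exp (∑ l, s l * k l) := by
  rw [genMatrix_apply]
  refine Finset.sum_congr rfl fun k _ => ?_
  rw [Real.exp_sum, mul_comm]
  congr 1
  refine Finset.prod_congr rfl fun l _ => ?_
  rw [Real.exp_mul, Real.rpow_intCast]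

variable [Fintype S]

/-- The vector `exp ∘ φ` satisfies `A_{***}(exp ∘ s) (exp ∘ φ) ≤ exp c • (exp ∘ φ)`. -/
def IsSubinvariant (P : Matrix (State S) (State S) ℝ) (s : Fin 3 → ℝ) (φ : S → ℝ) (c : ℝ) :
    Prop :=
  ∀ j, ∑ k ∈ increments, ∑ j', P (0, j) (k, j') *
    Real.exp (∑ l, s l * k l + φ j' - φ j - c) ≤ 1

/-- The exponent is linear in `(s, φ, c)` jointly, so convexity of `exp` suffices and no eigenvalue
enters. -/
lemma IsSubinvariant.convexCombo (hP : IsTransition P) {s s' : Fin 3 → ℝ} {φ φ' : S → ℝ}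
    {c c' : ℝ} (h : IsSubinvariant P s φ c) (h' : IsSubinvariant P s' φ' c') {a b : ℝ}
    (ha : 0 ≤ a) (hb : 0 ≤ b) (hab : a + b = 1) :
    IsSubinvariant P (a • s + b • s') (a • φ + b • φ') (a * c + b * c') := by
  intro j
  calc _ ≤ ∑ k ∈ increments, ∑ j',
        (a * (P (0, j) (k, j') * Real.exp (∑ l, s l * k l + φ j' - φ j - c)) +
          b * (P (0, j) (k, j') * Real.exp (∑ l, s' l * k l + φ' j' - φ' j - c'))) := by
        refine Finset.sum_le_sum fun k _ => Finset.sum_le_sum fun j' _ => ?_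
        have hc := convexOn_exp.2 (Set.mem_univ (∑ l, s l * k l + φ j' - φ j - c))
          (Set.mem_univ (∑ l, s' l * k l + φ' j' - φ' j - c')) ha hb hab
        simp only [smul_eq_mul] at hc
        refine (mul_le_mul_of_nonneg_left ((Real.exp_le_exp.2 (le_of_eq ?_)).trans hc)
          (hP.nonneg _ _)).trans_eq (by ring)
        simp only [Pi.add_apply, Pi.smul_apply, smul_eq_mul, Fin.sum_univ_three]
        ring
    _ = a * (∑ k ∈ increments, ∑ j', P (0, j) (k, j') *
            Real.exp (∑ l, s l * k l + φ j' - φ j - c)) +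
          b * ∑ k ∈ increments, ∑ j', P (0, j) (k, j') *
            Real.exp (∑ l, s' l * k l + φ' j' - φ' j - c') := by
        simp only [Finset.sum_add_distrib, Finset.mul_sum]
    _ ≤ a * 1 + b * 1 := by gcongr; exacts [h j, h' j]
    _ = 1 := by simpa using hab

lemma sum_row_eq_one (hP : IsTransition P) (j : S) :
    ∑ k ∈ increments, ∑ j', P (0, j) (k, j') = 1 := by
  rw [← Finset.sum_product' increments Finset.univ fun k j' => P (0, j) (k, j'),
    ← (hP.stochastic (0, j)).tsum_eq]
  refine (tsum_eq_sum fun y hy => ?_).symm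
  by_contra h
  exact hy (Finset.mem_product.2 ⟨mem_increments_of_ne_zero hP h, Finset.mem_univ _⟩)

/-- Finiteness of the Green matrix of `A_{***}(exp ∘ s)` at `z` close to `1` provides almost
invariant vectors. -/
lemma exists_isSubinvariant_of_mem_gammaBar (hP : IsTransition P) {s : Fin 3 → ℝ}
    (hs : s ∈ gammaBar P) {c : ℝ} (hc : 0 < c) : ∃ φ, IsSubinvariant P s φ c := by
  classical
  set A := genMatrix P fun l => Real.exp (s l) with hA
  have hA0 : ∀ j j', 0 ≤ A j j' := fun j j' => by
    rw [hA, genMatrix_exp_apply]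
    exact Finset.sum_nonneg fun k _ => mul_nonneg (hP.nonneg _ _) (Real.exp_pos _).le
  have hcp : 1 ≤ CMatrix.cp (CMatrix.ofReal A) := by
    have : (CMatrix.cp (CMatrix.ofReal A))⁻¹ ≤ 1 := hs
    simpa using this
  have hlt : ENNReal.ofReal (Real.exp (-c)) < 1 := by
    rw [ENNReal.ofReal_lt_one]
    simpa using hc
  obtain ⟨z, ⟨-, hzfin⟩, hcz⟩ := lt_sSup_iff.1 (hlt.trans_le hcp)
  -- Row sums of the Green matrix `G = ∑ z ^ n A ^ n`. Since `G = I + z A G`, they satisfy `z A h ≤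
  -- h`, and the term `n = 0` makes them positive.
  let h : S → ℝ≥0∞ := fun j => ∑ j', ∑' n : ℕ, z ^ n * CMatrix.pow (CMatrix.ofReal A) n j j'
  have hfin : ∀ j, h j ≠ ∞ := fun j => (ENNReal.sum_lt_top.2 fun j' _ => hzfin j j').ne
  have hpos : ∀ j, h j ≠ 0 := by
    intro j h0
    have h1 := (Finset.sum_eq_zero_iff.1 h0) j (Finset.mem_univ j)
    have h2 := ENNReal.tsum_eq_zero.1 h1 0
    simp [CMatrix.pow, CMatrix.id] at h2
  have hle : ∀ j, z * ∑ j', ENNReal.ofReal (A j j') * h j' ≤ h j := by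
    intro j
    calc z * ∑ j', ENNReal.ofReal (A j j') * h j'
        = ∑ j', ∑' n : ℕ, z ^ (n + 1) * CMatrix.pow (CMatrix.ofReal A) (n + 1) j j' := by
          simp only [CMatrix.pow_succ', CMatrix.mul, tsum_fintype, h, Finset.mul_sum,
            ← ENNReal.tsum_mul_left]
          rw [Finset.sum_comm]
          refine Finset.sum_congr rfl fun j' _ => ?_
          rw [← Summable.tsum_finsetSum fun _ _ => ENNReal.summable]
          refine tsum_congr fun n => Finset.sum_congr rfl fun w _ => ?_
          simp only [CMatrix.ofReal, Matrix.map_apply]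
          ring
      _ ≤ h j := Finset.sum_le_sum fun j' _ =>
          ENNReal.tsum_comp_le_tsum_of_injective (Nat.succ_injective)
            fun n => z ^ n * CMatrix.pow (CMatrix.ofReal A) n j j'
  have hpos' : ∀ j, 0 < (h j).toReal := fun j => ENNReal.toReal_pos (hpos j) (hfin j)
  have hreal : ∀ j, Real.exp (-c) * ∑ j', A j j' * (h j').toReal ≤ (h j).toReal := by
    intro j
    rw [← ENNReal.ofReal_le_ofReal_iff (hpos' j).le, ENNReal.ofReal_toReal (hfin j),
      ENNReal.ofReal_mul (Real.exp_pos _).le,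
      ENNReal.ofReal_sum_of_nonneg fun j' _ => mul_nonneg (hA0 j j') (hpos' j').le]
    refine le_trans (mul_le_mul' hcz.le (le_of_eq ?_)) (hle j)
    refine Finset.sum_congr rfl fun j' _ => ?_
    rw [ENNReal.ofReal_mul (hA0 j j'), ENNReal.ofReal_toReal (hfin j')]
  refine ⟨fun j => Real.log (h j).toReal, fun j => ?_⟩
  calc _ = (Real.exp (-c) * ∑ j', A j j' * (h j').toReal) / (h j).toReal := by
        rw [Finset.sum_comm, Finset.mul_sum, Finset.sum_div]
        refine Finset.sum_congr rfl fun j' _ => ?_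
        rw [hA, genMatrix_exp_apply, Finset.sum_mul, Finset.mul_sum, Finset.sum_div]
        refine Finset.sum_congr rfl fun k _ => ?_
        rw [sub_eq_add_neg _ c, Real.exp_add, Real.exp_sub, Real.exp_add,
          Real.exp_log (hpos' j), Real.exp_log (hpos' j')]
        ring
    _ ≤ 1 := (div_le_one (hpos' j)).2 (hreal j)

/-! ### Poisson's equation and the effect of a nonzero drift. -/

/-- Harmonic functions of `A_{***}(1, 1, 1)` are constant. -/
lemma eq_of_harmonic (hP : IsTransition P) (hirr : (trunc P).IsIrreducible) {g : S → ℝ}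
    (hg : ∀ j, ∑ k ∈ increments, ∑ j', P (0, j) (k, j') * g j' = g j) (j j' : S) :
    g j = g j' := by
  have : Nonempty S := ⟨j⟩
  obtain ⟨m, hm⟩ := Finite.exists_max g
  -- Maximum principle: an average of values at most `g m` equals `g m` only if every value of
  -- positive weight does.
  have hstep : ∀ a b k, g a = g m → 0 < P (0, a) (k, b) → g b = g m := by
    intro a b k ha hab
    have hz : ∑ k ∈ increments, ∑ j', P (0, a) (k, j') * (g m - g j') = 0 := by
      simp only [mul_sub, Finset.sum_sub_distrib, ← Finset.sum_mul]
      rw [sum_row_eq_one hP, hg, ha]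
      ring
    have hnn : ∀ k j', 0 ≤ P (0, a) (k, j') * (g m - g j') := fun k j' =>
      mul_nonneg (hP.nonneg _ _) (sub_nonneg.2 (hm j'))
    have h1 := (Finset.sum_eq_zero_iff_of_nonneg fun k _ =>
      Finset.sum_nonneg fun j' _ => hnn k j').1 hz k (mem_increments_of_ne_zero hP hab.ne')
    have h2 := (Finset.sum_eq_zero_iff_of_nonneg fun j' _ => hnn k j').1 h1 b
      (Finset.mem_univ b)
    rcases mul_eq_zero.1 h2 with h | h
    · exact absurd h hab.ne'
    · linarith
  have hall : ∀ b, g b = g m := by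
    intro b
    let : Quiver (StatePos S) := (trunc P).toQuiver
    -- Irreducibility is known for the truncated walk; a path there projects to a path of background
    -- states.
    obtain ⟨p, -⟩ := hirr.connected ((0 : Fin 3 → ℕ), m) ((0 : Fin 3 → ℕ), b)
    have : ∀ y : StatePos S, Quiver.Path ((0 : Fin 3 → ℕ), m) y → g y.2 = g m := by
      intro y q
      induction q with
      | nil => rfl
      | @cons y y' _ e ih =>
        refine hstep y.2 y'.2 (fun l => (y'.1 l : ℤ) - y.1 l) ih ?_
        have he : 0 < trunc P y y' := e.down
        rw [trunc] at he
        rw [← hP.homogeneous (fun l => (y.1 l : ℤ))]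
        convert he using 3
        · simp
        · funext l
          simp
    exact this _ p
  rw [hall j, hall j']

/-- Poisson's equation for `A_{***}(1, 1, 1)`. -/
lemma exists_poisson (hP : IsTransition P) (hirr : (trunc P).IsIrreducible) {π : S → ℝ}
    (hπ : IsStationary P π) {b : S → ℝ} (hb : ∑ j, π j * b j = 0) :
    ∃ g : S → ℝ, ∀ j, g j - ∑ k ∈ increments, ∑ j', P (0, j) (k, j') * g j' = b j := by
  classical
  set A := genMatrix P 1 with hA
  have hAg : ∀ g j, A.mulVec g j = ∑ k ∈ increments, ∑ j', P (0, j) (k, j') * g j' := by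
    intro g j
    simp only [Matrix.mulVec, dotProduct, hA, genMatrix_apply, Finset.sum_mul]
    rw [Finset.sum_comm]
    simp
  let T : (S → ℝ) →ₗ[ℝ] (S → ℝ) := LinearMap.id - A.mulVecLin
  have hT : ∀ g, T g = g - A.mulVec g := fun g => rfl
  let ℓ : (S → ℝ) →ₗ[ℝ] ℝ := dotProductBilin ℝ ℝ π
  have hℓ : ∀ g, ℓ g = dotProduct π g := fun g => rfl
  have hle : T.range ≤ ℓ.ker := by
    rintro _ ⟨g, rfl⟩
    rw [LinearMap.mem_ker, hℓ, hT, dotProduct_sub, Matrix.dotProduct_mulVec, hπ.2, sub_self]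
  have hker : T.ker ≤ Submodule.span ℝ {(1 : S → ℝ)} := by
    intro g hg
    rw [LinearMap.mem_ker, hT, sub_eq_zero] at hg
    have hconst := eq_of_harmonic hP hirr (g := g) fun j => by rw [← hAg, ← hg]
    rw [Submodule.mem_span_singleton]
    rcases isEmpty_or_nonempty S with hS | ⟨⟨j0⟩⟩
    · exact ⟨0, Subsingleton.elim _ _⟩
    · exact ⟨g j0, funext fun j => by simpa using hconst j0 j⟩
  have hker1 : Module.finrank ℝ T.ker ≤ 1 :=
    (Submodule.finrank_mono hker).trans (finrank_span_le_card {(1 : S → ℝ)} |>.trans (by simp))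
  have hℓne : ℓ ≠ 0 := by
    intro h
    have h1 : ℓ 1 = 1 := by rw [hℓ]; simpa [dotProduct] using hπ.1.2
    rw [h] at h1
    simp at h1
  have hrank := LinearMap.finrank_range_add_finrank_ker T
  have hrankℓ := LinearMap.finrank_range_add_finrank_ker ℓ
  rw [LinearMap.range_eq_top.2 (LinearMap.surjective hℓne), finrank_top,
    Module.finrank_self] at hrankℓ
  -- Fredholm alternative by counting: the kernel of `I - A` has dimension at most 1, so its range
  -- has codimension at most 1, and it lies in the hyperplane `ℓ.ker`.
  have heq : T.range = ℓ.ker := Submodule.eq_of_le_of_finrank_le hle (by omega)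
  have hbmem : b ∈ T.range := by
    rw [heq, LinearMap.mem_ker, hℓ]
    exact hb
  obtain ⟨g, hg⟩ := hbmem
  refine ⟨g, fun j => ?_⟩
  rw [← hAg, ← hg, hT]
  rfl

lemma meanDrift_eq (π : S → ℝ) (i : Fin 3) :
    meanDrift P π i = ∑ j, π j * ∑ k ∈ increments, ∑ j', P (0, j) (k, j') * k i := by
  rw [meanDrift, dotProduct]
  refine Finset.sum_congr rfl fun j _ => ?_
  congr 1
  simp only [Matrix.mulVec, dotProduct, Matrix.sub_apply, Matrix.sum_apply, Pi.one_apply, mul_one,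
     Finset.sum_filter]
  rw [Finset.sum_comm]
  refine Finset.sum_congr rfl fun j' _ => ?_
  rw [← Finset.sum_sub_distrib]
  refine Finset.sum_congr rfl fun k hk => ?_
  have hki := Finset.mem_Icc.1 (Fintype.mem_piFinset.1 hk i)
  have : k i = -1 ∨ k i = 0 ∨ k i = 1 := by omega
  rcases this with h | h | h <;> simp [h, incrBlock]

/-- A nonzero drift makes `χ` smaller than `1` somewhere near the origin. -/
lemma exists_isSubinvariant_neg (hP : IsTransition P) (hirr : (trunc P).IsIrreducible) {π : S → ℝ}
    (hπ : IsStationary P π) {i : Fin 3} (hi : meanDrift P π i ≠ 0) :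
    ∃ s φ c, c < 0 ∧ IsSubinvariant P s φ c := by
  classical
  set a := meanDrift P π i with ha
  let D : S → ℝ := fun j => ∑ k ∈ increments, ∑ j', P (0, j) (k, j') * k i
  -- The corrector `g` evens out the drift: with it, `-(a * k i) + g j' - g j` has mean `-a ^ 2`
  -- from every background state `j`.
  obtain ⟨g, hg⟩ := exists_poisson hP hirr hπ (b := fun j => a ^ 2 - a * D j) (by
    simp only [mul_sub, Finset.sum_sub_distrib, ← Finset.sum_mul, hπ.1.2]
    simp only [mul_left_comm _ a, ← Finset.mul_sum]
    rw [← meanDrift_eq, ← ha]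
    ring)
  -- Half of the gain `a ^ 2` is given to `-c`; the other half leaves `F j` with slope `-(a ^ 2 /
  -- 2)` at 0, so `F j t ≤ 1` for small `t > 0`. Finiteness of `S` allows one `t` for all `j`.
  let x : S → (Fin 3 → ℤ) → S → ℝ := fun j k j' => -(a * k i) + g j' - g j + a ^ 2 / 2
  let F : S → ℝ → ℝ := fun j t => ∑ k ∈ increments, ∑ j', P (0, j) (k, j') * Real.exp (t * x j k j')
  have hF0 : ∀ j, F j 0 = 1 := fun j => by simpa [F] using sum_row_eq_one hP j
  have hsum : ∀ j, ∑ k ∈ increments, ∑ j', P (0, j) (k, j') * x j k j' = -(a ^ 2 / 2) := by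
    intro j
    have h1 : ∑ k ∈ increments, ∑ j', P (0, j) (k, j') * x j k j' =
        -(a * D j) + ∑ k ∈ increments, ∑ j', P (0, j) (k, j') * g j' +
          (∑ k ∈ increments, ∑ j', P (0, j) (k, j')) * (a ^ 2 / 2 - g j) := by
      simp only [D, x, Finset.mul_sum, Finset.sum_mul, ← Finset.sum_neg_distrib,
        ← Finset.sum_add_distrib]
      exact Finset.sum_congr rfl fun k _ => Finset.sum_congr rfl fun j' _ => by ring
    rw [h1, sum_row_eq_one hP]
    linarith [hg j]
  have hF : ∀ j, HasDerivAt (F j) (-(a ^ 2 / 2)) 0 := by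
    intro j
    rw [← hsum j]
    refine HasDerivAt.fun_sum fun k _ => HasDerivAt.fun_sum fun j' _ => ?_
    have := ((hasDerivAt_mul_const (x := (0 : ℝ)) (x j k j')).exp).const_mul (P (0, j) (k, j'))
    simpa using this
  have hev : ∀ j, ∀ᶠ t in 𝓝[>] (0 : ℝ), F j t ≤ 1 := by
    intro j
    have h1 := (hasDerivAt_iff_tendsto_slope_zero.1 (hF j)).mono_left
      (nhdsWithin_mono 0 fun t (ht : 0 < t) => ht.ne')
    have hneg : -(a ^ 2 / 2) < 0 := by
      have := pow_pos (abs_pos.2 hi) 2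
      rw [sq_abs] at this
      linarith
    filter_upwards [h1.eventually_lt_const hneg, self_mem_nhdsWithin] with t ht ht0
    rw [zero_add, hF0, smul_eq_mul] at ht
    have := neg_of_mul_neg_right ht (inv_nonneg.2 (le_of_lt ht0))
    linarith
  obtain ⟨t, ht, ht0⟩ := ((eventually_all.2 hev).and self_mem_nhdsWithin).exists
  have ht0 : 0 < t := ht0
  refine ⟨Pi.single i (-(t * a)), fun j => t * g j, -(t * (a ^ 2 / 2)), ?_, fun j => ?_⟩
  · have : 0 < a ^ 2 := by positivity
    have : 0 < t * (a ^ 2 / 2) := by positivity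
    linarith
  · refine le_trans (le_of_eq ?_) (ht j)
    refine Finset.sum_congr rfl fun k _ => Finset.sum_congr rfl fun j' _ => ?_
    have : ∑ l, (Pi.single i (-(t * a)) : Fin 3 → ℝ) l * k l = -(t * a) * k i := by
      rw [Finset.sum_eq_single i (fun l _ hl => by simp [hl]) (by simp)]
      simp
    rw [this]
    congr 2
    simp only [x]
    ring

/-! ### From subinvariant vectors to the rate matrix. -/

lemma withLevel_injective (i : Fin 3) {k k' : ℤ} {u u' : {l : Fin 3 // l ≠ i} → ℕ}
    (h : withLevel i k u = withLevel i k' u') : k = k' ∧ u = u' := by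
  refine ⟨by simpa [withLevel] using congrFun h i, funext fun l => ?_⟩
  simpa [withLevel, l.2] using congrFun h l

lemma sum_mul_withLevel (s : Fin 3 → ℝ) (i : Fin 3) (k : ℤ) (u : {l : Fin 3 // l ≠ i} → ℕ) :
    ∑ l, s l * withLevel i k u l = s i * k + ∑ l, s l * withLevel i 0 u l := by
  rw [← Finset.add_sum_erase _ _ (Finset.mem_univ i),
    ← Finset.add_sum_erase (a := i) Finset.univ (fun l => s l * (withLevel i 0 u l : ℝ))
      (Finset.mem_univ i)]
  have h : ∀ l ∈ Finset.univ.erase i, s l * (withLevel i k u l : ℝ) = s l * withLevel i 0 u l :=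
    fun l hl => by simp [withLevel, Finset.ne_of_mem_erase hl]
  rw [Finset.sum_congr rfl h]
  simp [withLevel]

/-- After translating the current state to the origin, the sum runs over part of the increments in
the subinvariance inequality: the phase keeps the other two coordinates nonnegative. -/
lemma IsSubinvariant.tsum_levelBlock_le (hP : IsTransition P) {s : Fin 3 → ℝ} {φ : S → ℝ} {c : ℝ}
    (h : IsSubinvariant P s φ c) (i : Fin 3) (u : Phase S i) :
    ∑' k : ℤ, ∑' v : Phase S i, ENNReal.ofReal (Real.exp (s i)) ^ k *
        CMatrix.ofReal (levelBlock P i k) u v *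
          ENNReal.ofReal (Real.exp (∑ l, s l * withLevel i 0 v.1 l + φ v.2)) ≤
      ENNReal.ofReal (Real.exp c) *
        ENNReal.ofReal (Real.exp (∑ l, s l * withLevel i 0 u.1 l + φ u.2)) := by
  let x := withLevel i 0 u.1
  let G : State S → ℝ := fun y => P (0, u.2) y * Real.exp (∑ l, s l * y.1 l + φ y.2 - φ u.2 - c)
  have hG0 : ∀ y, 0 ≤ G y := fun y => mul_nonneg (hP.nonneg _ _) (Real.exp_pos _).le
  let K : ℝ := Real.exp c * Real.exp (∑ l, s l * x l + φ u.2)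
  have hterm : ∀ k : ℤ, ∀ v : Phase S i, ENNReal.ofReal (Real.exp (s i)) ^ k *
        CMatrix.ofReal (levelBlock P i k) u v *
          ENNReal.ofReal (Real.exp (∑ l, s l * withLevel i 0 v.1 l + φ v.2)) =
      ENNReal.ofReal (G (withLevel i k v.1 - x, v.2)) * ENNReal.ofReal K := by
    intro k v
    have hp : levelBlock P i k u v = P (0, u.2) (withLevel i k v.1 - x, v.2) := by
      rw [levelBlock, ← hP.homogeneous x 0, zero_add, sub_add_cancel]
    rw [ofReal_exp_zpow, CMatrix.ofReal, Matrix.map_apply, hp,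
      ← ENNReal.ofReal_mul (by positivity),
      ← ENNReal.ofReal_mul (mul_nonneg (by positivity) (hP.nonneg _ _)),
      ← ENNReal.ofReal_mul (hG0 _)]
    congr 1
    simp only [G, K]
    have e1 : ∑ l, s l * ((withLevel i k v.1 - x) l : ℤ) =
        s i * k + ∑ l, s l * withLevel i 0 v.1 l - ∑ l, s l * x l := by
      rw [← sum_mul_withLevel, ← Finset.sum_sub_distrib]
      exact Finset.sum_congr rfl fun l _ => by rw [Pi.sub_apply]; push_cast; ring
    rw [e1, mul_comm (Real.exp (s i * k)), mul_assoc, mul_assoc,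
      ← Real.exp_add, ← Real.exp_add, ← Real.exp_add]
    congr 2
    ring
  have hinj : Function.Injective fun y : ℤ × Phase S i =>
      ((withLevel i y.1 y.2.1 - x, y.2.2) : State S) := by
    rintro ⟨k, v, j⟩ ⟨k', v', j'⟩ he
    obtain ⟨h1, h2⟩ := Prod.ext_iff.1 he
    obtain ⟨rfl, rfl⟩ := withLevel_injective i (sub_left_injective h1)
    obtain rfl : j = j' := h2
    rfl
  have hsumG : ∑' y, ENNReal.ofReal (G y) ≤ 1 := by
    rw [tsum_eq_sum (s := increments ×ˢ Finset.univ), ← ENNReal.ofReal_sum_of_nonneg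
      fun y _ => hG0 y, Finset.sum_product, ENNReal.ofReal_le_one]
    · exact h u.2
    · rintro ⟨k, j'⟩ hy
      have : P (0, u.2) (k, j') = 0 := by
        by_contra h0
        exact hy (Finset.mem_product.2 ⟨mem_increments_of_ne_zero hP h0, Finset.mem_univ _⟩)
      simp [G, this]
  simp only [hterm]
  rw [← ENNReal.tsum_prod (f := fun (k : ℤ) (v : Phase S i) =>
    ENNReal.ofReal (G (withLevel i k v.1 - x, v.2)) * ENNReal.ofReal K), ENNReal.tsum_mul_right,
    ← ENNReal.ofReal_mul (Real.exp_pos _).le]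
  calc _ ≤ (∑' y, ENNReal.ofReal (G y)) * ENNReal.ofReal K := by
        gcongr
        exact ENNReal.tsum_comp_le_tsum_of_injective hinj fun y => ENNReal.ofReal (G y)
    _ ≤ 1 * ENNReal.ofReal K := by gcongr
    _ = _ := one_mul _

lemma IsSubinvariant.tsum_pow_rate_lt_top (hP : IsTransition P) {s : Fin 3 → ℝ} {φ : S → ℝ}
    {c : ℝ} (h : IsSubinvariant P s φ c) (hc : c < 0) (i : Fin 3) (u v : Phase S i) :
    ∑' n : ℕ, ENNReal.ofReal (Real.exp (s i)) ^ n * CMatrix.pow (rate P i) n u v < ∞ :=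
  CMatrix.tsum_pow_rateMatrix_lt_top (by simpa using Real.exp_pos _) ENNReal.ofReal_ne_top
    (fun v => by simpa using Real.exp_pos _) (fun v => ENNReal.ofReal_ne_top)
    (by rw [ENNReal.ofReal_lt_one]; simpa using hc) (h.tsum_levelBlock_le hP i) u v

lemma IsSubinvariant.le_cp_rate (hP : IsTransition P) {s : Fin 3 → ℝ} {φ : S → ℝ} {c : ℝ}
    (h : IsSubinvariant P s φ c) (hc : c < 0) (i : Fin 3) :
    ENNReal.ofReal (Real.exp (s i)) ≤ CMatrix.cp (rate P i) :=
  le_sSup ⟨ENNReal.ofReal_ne_top, h.tsum_pow_rate_lt_top hP hc i⟩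

/-- The term `n = 1` of the finite series is a positive multiple of the entry. -/
lemma IsSubinvariant.rate_ne_top (hP : IsTransition P) {s : Fin 3 → ℝ} {φ : S → ℝ} {c : ℝ}
    (h : IsSubinvariant P s φ c) (hc : c < 0) (i : Fin 3) (u v : Phase S i) :
    rate P i u v ≠ ∞ := by
  have h1 := (ENNReal.le_tsum 1).trans_lt (h.tsum_pow_rate_lt_top hP hc i u v)
  rw [CMatrix.pow_one, _root_.pow_one] at h1
  exact (ENNReal.lt_top_of_mul_ne_top_right h1.ne (by simpa using Real.exp_pos _)).ne

lemma exp_le_cp_rate (hP : IsTransition P) {s₀ : Fin 3 → ℝ} {φ₀ : S → ℝ} {c₀ : ℝ}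
    (h₀ : IsSubinvariant P s₀ φ₀ c₀) (hc₀ : c₀ < 0) {s : Fin 3 → ℝ} (hs : s ∈ gammaBar P)
    (i : Fin 3) : ENNReal.ofReal (Real.exp (s i)) ≤ CMatrix.cp (rate P i) := by
  have hlim : Tendsto (fun t : ℝ => ENNReal.ofReal (Real.exp ((1 - t) * s i + t * s₀ i)))
      (𝓝[>] 0) (𝓝 (ENNReal.ofReal (Real.exp (s i)))) := by
    have : Continuous fun t : ℝ => ENNReal.ofReal (Real.exp ((1 - t) * s i + t * s₀ i)) :=
      ENNReal.continuous_ofReal.comp (by fun_prop)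
    simpa using (this.tendsto 0).mono_left nhdsWithin_le_nhds
  refine le_of_tendsto hlim ?_
  filter_upwards [Ioo_mem_nhdsGT one_pos] with t ht
  -- With weight `t` on the strict point, the error `-(t * c₀) / 2` costs at most half of the gain
  -- `t * c₀`, so the combined constant stays negative.
  obtain ⟨φ, hφ⟩ := exists_isSubinvariant_of_mem_gammaBar hP hs (c := -(t * c₀) / 2)
    (by nlinarith [mul_neg_of_pos_of_neg ht.1 hc₀])
  have hneg : (1 - t) * (-(t * c₀) / 2) + t * c₀ < 0 := by
    nlinarith [mul_neg_of_pos_of_neg ht.1 hc₀, ht.1]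
  exact (hφ.convexCombo hP h₀ (a := 1 - t) (b := t) (by linarith [ht.2]) ht.1.le
    (by ring)).le_cp_rate hP hneg i

end MMRW

theorem mainTheorem3 {S : Type*} [Fintype S]
    (P : Matrix (MMRW.State S) (MMRW.State S) ℝ) (hP : MMRW.IsTransition P)
    (π : S → ℝ) (hπ : MMRW.IsStationary P π)
    (hdrift : ∀ i, MMRW.meanDrift P π i ≠ 0) (hneg : ∃ i, MMRW.meanDrift P π i < 0)
    (hirr : (MMRW.trunc P).IsIrreducible) (haper : CMatrix.IsAperiodic (MMRW.trunc P))
    (hrow : ∀ i : Fin 3, ∀ u : MMRW.Phase S i, ∃ v, 0 < MMRW.levelBlock P i 1 u v)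
    (i : Fin 3) :
    (∀ u v, MMRW.rate P i u v ≠ ∞) ∧ MMRW.zMax P i ≤ CMatrix.cp (MMRW.rate P i) := by
  obtain ⟨s₀, φ₀, c₀, hc₀, h₀⟩ := MMRW.exists_isSubinvariant_neg hP hirr hπ (hdrift i)
  refine ⟨h₀.rate_ne_top hP hc₀ i, ?_⟩
  rw [MMRW.zMax, ← ENNReal.exp_log (CMatrix.cp (MMRW.rate P i)), EReal.exp_le_exp_iff, MMRW.sMax]
  refine iSup₂_le fun s hs => ?_
  rw [← EReal.exp_le_exp_iff, ENNReal.exp_log, EReal.exp_coe]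
  exact MMRW.exp_le_cp_rate hP h₀ hc₀ hs i
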